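/- Let $n\ge 1$ and $r\ge 0$ be integers. For $A\in\mathbb R^{n\times n}$, $B\in\mathbb R^{n\times r}$ and $N\ge 0$ let $P_N=[B,AB,\dots,A^{N-1}B]=[p_1,\dots,p_{rN}]$, let $$E_n(P_N)=\Big\{\sum_{i=1}^{rN}c_ip_i \;:\; c_i\in[0,1]\Big\}\subset\mathbb R^n$$ be the zonotope generated by the pair $\{A,B\}$, and let $V_n$ denote $n$-dimensional volume (Lebesgue measure). Then for all $A$, $B$ (with no rank assumption) and all $N\ge 2$, $$V_n(E_n(P_N))=(1+|\det A|)\,V_n(E_n(P_{N-1}))-|\det A|\,V_n(E_n(P_{N-2}))+\sum_{j=1}^{r}\sum_{k=1}^{r}\ \sum_{(i_1,\dots,i_n)\in\Theta_{0,0}^{j}\times\Theta_{1,N-2}^{n-j-k}\times\Theta_{N-1,N-1}^{k}}\big|\det[p_{i_1},\dots,p_{i_n}]\big| .$$ Here $\Theta_{a,b}^{m}$ is the set of strictly increasing $m$-tuples with entries in $\{ra+1,\dots,r(b+1)\}$, the product of such sets is the set of concatenated tuples, and terms with $n-j-k<0$ are absent; that is, the sum runs over the $n$-column submatrices of $P_N$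 that contain columns both of $B$ and of $A^{N-1}B$. Consequently $V_n(E_n(P_N))$ is computed, for every $A$, $B$ and $N$, by the following algorithm. Compute $|\det A|$ once; start from $V_n(E_n(P_0))=0$ and $V_n(E_n(P_1))=\sum_{i_1<\dots<i_n}|\det[b_{i_1},\dots,b_{i_n}]|$, where $b_1,\dots,b_r$ are the columns of $B$; at each stage $M=2,\dots,N$, form the block $A^{M-1}B=A\cdot A^{M-2}B$ and evaluate the recursion. The computational complexity of the whole computation, measured by the number of $n\times n$ determinants evaluated, is $O(N^{n-1})$, and the number of all other arithmetic operations on real numbers is $O(N^{\max(n-1,1)})$; the constants depend only on $n$ and $r$. -/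

import Mathlib

open MeasureTheory

/-- The zonotope spanned by the columns of `Z`: all combinations of the columns with coefficients
in `[0, 1]`. -/
def zonotope {n m : ℕ} (Z : Matrix (Fin n) (Fin m) ℝ) : Set (Fin n → ℝ) :=
  {x | ∃ c : Fin m → ℝ, (∀ i, c i ∈ Set.Icc (0 : ℝ) 1) ∧ x = ∑ i, c i • Z.col i}

/-- A zonotope is compact, so its Lebesgue measure is finite. -/
theorem isCompact_zonotope {n m : ℕ} (Z : Matrix (Fin n) (Fin m) ℝ) :
    IsCompact (zonotope Z) := by
  have h : zonotope Z =
      (fun c : Fin m → ℝ => ∑ i, c i • Z.col i) '' Set.pi Set.univ (fun _ => Set.Icc (0 : ℝ) 1) := by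
    ext x
    simp only [zonotope, Set.mem_ofPred_eq, Set.mem_image, Set.mem_pi, Set.mem_univ, true_imp_iff]
    exact ⟨fun ⟨c, hc, hx⟩ => ⟨c, hc, hx.symm⟩, fun ⟨c, hc, hx⟩ => ⟨c, hc, hx.symm⟩⟩
  rw [h]
  exact (isCompact_univ_pi fun _ => isCompact_Icc).image (by fun_prop)

/-- The matrix `[X₀, X₁, …, X_{N-1}]` with the blocks `X_k` side by side. Columns are numbered from
`0`; column `i` is column `i mod r` of block number `⌊i / r⌋`. -/
def blockRow {n r N : ℕ} (X : Fin N → Matrix (Fin n) (Fin r) ℝ) :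
    Matrix (Fin n) (Fin (N * r)) ℝ :=
  Matrix.of fun a i => X i.divNat a i.modNat

/-- The controllability matrix `P_N = [B, AB, …, A^{N-1}B]` of the pair `{A, B}`. -/
def ctrbMatrix {n r : ℕ} (A : Matrix (Fin n) (Fin n) ℝ) (B : Matrix (Fin n) (Fin r) ℝ) (N : ℕ) :
    Matrix (Fin n) (Fin (N * r)) ℝ :=
  blockRow fun k : Fin N => A ^ (k : ℕ) * B

/-- The `n`-dimensional volume (Lebesgue measure) of the zonotope generated by the columns of
`P_N = [B, AB, …, A^{N-1}B]`. -/
noncomputable def ctrbVolume {n r : ℕ} (A : Matrix (Fin n) (Fin n) ℝ)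
    (B : Matrix (Fin n) (Fin r) ℝ) (N : ℕ) : ℝ :=
  volume.real (zonotope (ctrbMatrix A B N))

open Classical in
/-- The column labels of the `n`-column submatrices of a matrix with `m` columns: the strictly
increasing `n`-tuples of elements of `{0, …, m-1}`. -/
noncomputable def sortedTuples (n m : ℕ) : Finset (Fin n → Fin m) :=
  Finset.univ.filter fun i => StrictMono i

open Classical in
/-- The sorted column-label `n`-tuples for a matrix of `N` blocks of `r` columns whose first `j`
entries lie in block `0`, whose last `k` entries lie in block `N - 1`, and whose `n - j - k`
entries in between lie in the blocks `1, …, N - 2`. The set is empty when `n < j + k`. -/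
noncomputable def mixedTuples (n r N j k : ℕ) : Finset (Fin n → Fin (N * r)) :=
  (sortedTuples n (N * r)).filter fun i => j + k ≤ n ∧ ∀ l : Fin n,
    ((l : ℕ) < j → ((i l).divNat : ℕ) = 0) ∧
    (j ≤ (l : ℕ) → (l : ℕ) < n - k → 1 ≤ ((i l).divNat : ℕ) ∧ ((i l).divNat : ℕ) + 2 ≤ N) ∧
    (n - k ≤ (l : ℕ) → ((i l).divNat : ℕ) + 1 = N)

/-- A result together with the cost of computing it: the number `dets` of evaluations of
determinants of `n × n` matrices, and the number `ops` of all other arithmetic operations on real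
numbers. Handling of column labels and access to stored numbers are free. -/
structure Counted (α : Type) where
  val : α
  dets : ℕ
  ops : ℕ

namespace Counted

/-- Results cost nothing to return, and the costs of consecutive computations add up. -/
instance : Monad Counted where
  pure a := ⟨a, 0, 0⟩
  bind x f := ⟨(f x.val).val, x.dets + (f x.val).dets, x.ops + (f x.val).ops⟩

/-- One addition. -/
noncomputable def add (x y : ℝ) : Counted ℝ := ⟨x + y, 0, 1⟩

/-- One subtraction. -/
noncomputable def sub (x y : ℝ) : Counted ℝ := ⟨x - y, 0, 1⟩

/-- One multiplication. -/
noncomputable def mul (x y : ℝ) : Counted ℝ := ⟨x * y, 0, 1⟩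

/-- The absolute value of a determinant: one determinant and one further operation. -/
noncomputable def absDet {n : ℕ} (M : Matrix (Fin n) (Fin n) ℝ) : Counted ℝ := ⟨|M.det|, 1, 1⟩

/-- The schoolbook product of an `n × n` and an `n × r` matrix: `n` multiplications and `n`
additions for each of the `n * r` entries. -/
noncomputable def matMul {n r : ℕ} (A : Matrix (Fin n) (Fin n) ℝ) (X : Matrix (Fin n) (Fin r) ℝ) :
    Counted (Matrix (Fin n) (Fin r) ℝ) := ⟨A * X, 0, n * r * (n + n)⟩

/-- Compute `f i` for every `i ∈ s` and add the results up, with one addition for each `i`. -/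
noncomputable def sum {ι : Type} (s : Finset ι) (f : ι → Counted ℝ) : Counted ℝ :=
  ⟨∑ i ∈ s, (f i).val, ∑ i ∈ s, (f i).dets, ∑ i ∈ s, ((f i).ops + 1)⟩

end Counted

/-- The data kept by the recursive algorithm after stage `N`. -/
structure VolumeState (n r N : ℕ) where
  /-- the volume for `P_N` -/
  cur : ℝ
  /-- the volume for `P_{N-1}` -/
  prev : ℝ
  /-- the blocks `B, AB, …, A^{N-1}B` -/
  blocks : Fin N → Matrix (Fin n) (Fin r) ℝ

/-- The stages of the recursive algorithm, given `d = |det A|`: `volumeStage A B d N` is the state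
after stage `N + 1`. Stage `1` adds up the absolute values of the `n × n` minors of `B`, and every
later stage computes one new block and evaluates the recursion once. -/
noncomputable def volumeStage {n r : ℕ} (A : Matrix (Fin n) (Fin n) ℝ)
    (B : Matrix (Fin n) (Fin r) ℝ) (d : ℝ) : (N : ℕ) → Counted (VolumeState n r (N + 1))
  | 0 => do
      let v ← Counted.sum (sortedTuples n r) fun i => Counted.absDet (B.submatrix id i)
      pure ⟨v, 0, fun _ => B⟩
  | N + 1 => do
      let S ← volumeStage A B d N
      let X ← Counted.matMul A (S.blocks (Fin.last N))
      let blocks : Fin (N + 2) → Matrix (Fin n) (Fin r) ℝ := Fin.snoc S.blocks X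
      let s ← Counted.sum (Finset.Icc 1 r) fun j => Counted.sum (Finset.Icc 1 r) fun k =>
        Counted.sum (mixedTuples n r (N + 2) j k) fun i =>
          Counted.absDet ((blockRow blocks).submatrix id i)
      let e ← Counted.add 1 d
      let x ← Counted.mul e S.cur
      let y ← Counted.mul d S.prev
      let z ← Counted.sub x y
      let v ← Counted.add z s
      pure ⟨v, S.cur, blocks⟩

/-- The recursive algorithm for the volume of the zonotope generated by `P_N`: `|det A|` is computed
once, and then the stages `1, …, N` are run. -/
noncomputable def recursiveVolume {n r : ℕ} (A : Matrix (Fin n) (Fin n) ℝ)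
    (B : Matrix (Fin n) (Fin r) ℝ) : ℕ → Counted ℝ
  | 0 => pure 0
  | N + 1 => do
      let d ← Counted.absDet A
      let S ← volumeStage A B d N
      pure S.cur

/-!
The recursion rests on the formula `volume_zonotope`: the volume of a zonotope generated by the
columns of `Z` is the sum of `|det|` over all `n`-column submatrices of `Z`. It is proved by
induction on the number of generators. Adding the last generator `v` sweeps the convex body `K`
generated by the others along `v`. After a linear change of coordinates `v` is a unit vector of the
standard basis, every nonempty fibre of `K` in the direction of `v` is an interval which becomes
longer by `1`, and the volume grows by the volume of the projection of `K` along `v`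
(`volume_add_segment_single`). That projection is again a zonotope, and by expansion along the
column `v` its minors are the minors of `Z` that contain `v`.

Granted this, the recursion is inclusion–exclusion on the set of sorted `n`-tuples of column labels
of `P_N`. The tuples that avoid the last block contribute the volume for `P_{N-1}`. Those that avoid
the first block choose columns of `A P_{N-1}` and contribute `|det A|` times that volume; those that
avoid both contribute `|det A|` times the volume for `P_{N-2}`. What remains are the tuples that
meet both blocks, sorted by the numbers `j, k ≥ 1` of labels in the two blocks (`sum_mixedTuples`).

For the cost, a tuple that meets both the first and the last block has only `n - 2` labels that range
freely over the `N r` columns, so that stage `N` takes `O(N^{n-2})` determinants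
(`card_mixedTuples_le`), and none at all for `n = 1`. Summing over the stages gives `O(N^{n-1})`;
the bounded overhead of each stage adds `O(N)` further operations.
-/

/-! ### Zonotopes and volumes of swept convex bodies -/

section Pointwise

open scoped Pointwise

theorem convex_zonotope {n m : ℕ} (Z : Matrix (Fin n) (Fin m) ℝ) : Convex ℝ (zonotope Z) := by
  rintro x ⟨c, hc, rfl⟩ y ⟨d, hd, rfl⟩ a b ha hb hab
  refine ⟨a • c + b • d, fun i => convex_Icc (0 : ℝ) 1 (hc i) (hd i) ha hb hab, ?_⟩
  simp only [Finset.smul_sum, ← Finset.sum_add_distrib, Pi.add_apply, Pi.smul_apply, add_smul,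
    smul_eq_mul, mul_smul]

theorem zonotope_nonempty {n m : ℕ} (Z : Matrix (Fin n) (Fin m) ℝ) : (zonotope Z).Nonempty :=
  ⟨0, 0, by simp, by simp⟩

theorem zonotope_mul {n k m : ℕ} (T : Matrix (Fin k) (Fin n) ℝ) (Z : Matrix (Fin n) (Fin m) ℝ) :
    zonotope (T * Z) = Matrix.toLin' T '' zonotope Z := by
  have key : ∀ c : Fin m → ℝ, ∑ i, c i • (T * Z).col i
      = Matrix.toLin' T (∑ i, c i • Z.col i) := by
    intro c
    rw [map_sum]
    refine Finset.sum_congr rfl fun i _ => ?_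
    rw [map_smul]
    rfl
  ext x
  constructor
  · rintro ⟨c, hc, rfl⟩
    exact ⟨_, ⟨c, hc, rfl⟩, (key c).symm⟩
  · rintro ⟨_, ⟨c, hc, rfl⟩, rfl⟩
    exact ⟨c, hc, (key c).symm⟩

theorem volume_zonotope_mul {n m : ℕ} (T : Matrix (Fin n) (Fin n) ℝ)
    (Z : Matrix (Fin n) (Fin m) ℝ) :
    volume (zonotope (T * Z)) = ENNReal.ofReal |T.det| * volume (zonotope Z) := by
  rw [zonotope_mul, Measure.addHaar_image_linearMap, LinearMap.det_toLin']

/-- Splitting off the last generator. -/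
theorem zonotope_succ {n m : ℕ} (Z : Matrix (Fin n) (Fin (m + 1)) ℝ) :
    zonotope Z = zonotope (Z.submatrix id Fin.castSucc)
      + (fun t : ℝ => t • Z.col (Fin.last m)) '' Set.Icc 0 1 := by
  ext x
  simp only [Set.mem_add, Set.mem_image]
  constructor
  · rintro ⟨c, hc, rfl⟩
    refine ⟨_, ⟨fun i => c i.castSucc, fun i => hc _, rfl⟩, _, ⟨c (Fin.last m), hc _, rfl⟩, ?_⟩
    rw [Fin.sum_univ_castSucc]
    rfl
  · rintro ⟨_, ⟨c, hc, rfl⟩, _, ⟨t, ht, rfl⟩, rfl⟩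
    refine ⟨Fin.snoc c t, fun i => ?_, ?_⟩
    · induction i using Fin.lastCases with
      | last => simpa using ht
      | cast i => simpa using hc i
    · rw [Fin.sum_univ_castSucc]
      simp only [Fin.snoc_castSucc, Fin.snoc_last]
      rfl

/-- Cavalieri's principle for slices parallel to the last coordinate axis. -/
theorem volume_eq_lintegral_snoc {n : ℕ} {S : Set (Fin (n + 1) → ℝ)} (hS : MeasurableSet S) :
    volume S = ∫⁻ y : Fin n → ℝ, volume {t : ℝ | (Fin.snoc y t : Fin (n + 1) → ℝ) ∈ S} := by
  have hp := (volume_preserving_piFinSuccAbove (fun _ : Fin (n + 1) => ℝ) (Fin.last n)).symm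
  rw [← hp.measure_preimage_equiv S, Measure.volume_eq_prod,
    Measure.prod_apply_symm (hS.preimage (MeasurableEquiv.measurable _))]
  refine lintegral_congr fun y => ?_
  congr 1
  ext t
  simp [MeasurableEquiv.piFinSuccAbove, Fin.insertNthEquiv]

theorem volume_add_Icc_zero_one {s : Set ℝ} (hc : IsCompact s) (hs : Convex ℝ s)
    (hne : s.Nonempty) : volume (s + Set.Icc 0 1) = volume s + 1 := by
  obtain ⟨a, b, hab, rfl⟩ : ∃ a b, a ≤ b ∧ s = Set.Icc a b := by
    have hI := eq_Icc_of_connected_compact ⟨hne, hs.isPreconnected⟩ hc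
    exact ⟨_, _, Set.nonempty_Icc.1 (hI ▸ hne), hI⟩
  rw [Set.Icc_add_Icc hab zero_le_one, Real.volume_Icc, Real.volume_Icc, ← ENNReal.ofReal_one,
    ← ENNReal.ofReal_add (sub_nonneg.2 hab) zero_le_one]
  congr 1
  ring

/-- Sweeping a convex body along the last unit vector adds the volume of its shadow: every fibre
over the shadow is an interval, and it grows by length one. -/
theorem volume_add_segment_single {n : ℕ} {K : Set (Fin (n + 1) → ℝ)} (hK : IsCompact K)
    (hconv : Convex ℝ K) :
    volume (K + (fun t : ℝ => t • (Pi.single (Fin.last n) 1 : Fin (n + 1) → ℝ)) '' Set.Icc 0 1)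
      = volume K + volume ((fun x : Fin (n + 1) → ℝ => (Fin.init x : Fin n → ℝ)) '' K) := by
  have hinit : Continuous fun x : Fin (n + 1) → ℝ => (Fin.init x : Fin n → ℝ) :=
    continuous_pi fun i => continuous_apply _
  have hsnoc : ∀ y : Fin n → ℝ, Continuous fun t : ℝ => (Fin.snoc y t : Fin (n + 1) → ℝ) := by
    intro y
    refine continuous_pi fun i => ?_
    induction i using Fin.lastCases with
    | last => simpa using continuous_id'
    | cast i => simpa using continuous_const
  have hsh : MeasurableSet ((fun x : Fin (n + 1) → ℝ => (Fin.init x : Fin n → ℝ)) '' K) :=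
    (hK.image hinit).measurableSet
  have hseg : IsCompact
      ((fun t : ℝ => t • (Pi.single (Fin.last n) 1 : Fin (n + 1) → ℝ)) '' Set.Icc 0 1) :=
    isCompact_Icc.image (by fun_prop)
  rw [volume_eq_lintegral_snoc (hK.add hseg).measurableSet,
    volume_eq_lintegral_snoc hK.measurableSet, ← lintegral_indicator_one hsh,
    ← lintegral_add_right _ (measurable_one.indicator hsh)]
  refine lintegral_congr fun y => ?_
  set s : Set ℝ := {t : ℝ | (Fin.snoc y t : Fin (n + 1) → ℝ) ∈ K} with hs
  have hfib : {t : ℝ | (Fin.snoc y t : Fin (n + 1) → ℝ) ∈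
      K + (fun t : ℝ => t • (Pi.single (Fin.last n) 1 : Fin (n + 1) → ℝ)) '' Set.Icc 0 1}
      = s + Set.Icc 0 1 := by
    have hadd : ∀ a u : ℝ, (Fin.snoc y a : Fin (n + 1) → ℝ)
        + u • (Pi.single (Fin.last n) 1 : Fin (n + 1) → ℝ) = Fin.snoc y (a + u) := by
      intro a u
      ext i
      induction i using Fin.lastCases with
      | last => simp
      | cast i => simp [Fin.castSucc_ne_last]
    ext t
    simp only [Set.mem_ofPred_eq, Set.mem_add, Set.mem_image, hs]
    constructor
    · rintro ⟨z, hz, _, ⟨u, hu, rfl⟩, h⟩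
      refine ⟨t - u, ?_, u, hu, by ring⟩
      have : z = Fin.snoc y (t - u) := by
        rw [eq_sub_of_add_eq h, sub_eq_iff_eq_add, hadd, sub_add_cancel]
      rwa [← this]
    · rintro ⟨a, ha, u, hu, rfl⟩
      exact ⟨_, ha, _, ⟨u, hu, rfl⟩, hadd a u⟩
  rw [hfib]
  by_cases hy : y ∈ (fun x : Fin (n + 1) → ℝ => (Fin.init x : Fin n → ℝ)) '' K
  · rw [Set.indicator_of_mem hy]
    obtain ⟨x, hx, hxy⟩ := hy
    have hne : s.Nonempty := by
      refine ⟨x (Fin.last n), ?_⟩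
      simp only [hs, Set.mem_ofPred_eq, ← hxy, Fin.snoc_init_self]
      exact hx
    have hcl : IsClosed s := hK.isClosed.preimage (hsnoc y)
    have hcomp : IsCompact s := by
      refine (hK.image (continuous_apply (Fin.last n))).of_isClosed_subset hcl fun t ht => ?_
      exact ⟨_, ht, by simp⟩
    have hcv : Convex ℝ s := by
      intro a ha b hb p q hp hq hpq
      have := hconv ha hb hp hq hpq
      simp only [hs, Set.mem_ofPred_eq]
      convert this using 1
      ext i
      induction i using Fin.lastCases with
      | last => simp
      | cast i => simp [← add_mul, hpq]
    rw [volume_add_Icc_zero_one hcomp hcv hne]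
    rfl
  · have he : s = ∅ := by
      refine Set.eq_empty_of_forall_notMem fun t ht => hy ⟨_, ht, ?_⟩
      simp
    rw [he, Set.empty_add, Set.indicator_of_notMem hy]
    simp

end Pointwise

/-! ### Sums over sorted tuples -/

theorem mem_sortedTuples {n m : ℕ} {i : Fin n → Fin m} : i ∈ sortedTuples n m ↔ StrictMono i := by
  simp [sortedTuples]

theorem sortedTuples_succ_zero (n : ℕ) : sortedTuples (n + 1) 0 = ∅ := by
  ext i
  exact (i 0).elim0

theorem sum_sortedTuples_zero {M : Type*} [AddCommMonoid M] (m : ℕ) (f : (Fin 0 → Fin m) → M) :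
    ∑ i ∈ sortedTuples 0 m, f i = f Fin.elim0 := by
  have : sortedTuples 0 m = {Fin.elim0} := by
    ext i
    simp [mem_sortedTuples, Subsingleton.elim i Fin.elim0, Subsingleton.strictMono]
  rw [this, Finset.sum_singleton]

/-- Sorted tuples with all entries in the range of an order embedding `e` are the images under `e`
of sorted tuples. -/
theorem sum_sortedTuples_filter_range {M : Type*} [AddCommMonoid M] {n m k : ℕ}
    (e : Fin m ↪o Fin k) (f : (Fin n → Fin k) → M) (p : (Fin n → Fin k) → Prop)
    [DecidablePred p] (hp : ∀ i, p i ↔ ∀ l, i l ∈ Set.range e) :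
    ∑ i ∈ (sortedTuples n k).filter p, f i = ∑ i ∈ sortedTuples n m, f (fun l => e (i l)) := by
  symm
  refine Finset.sum_bij (fun i _ l => e (i l)) ?_ ?_ ?_ (fun _ _ => rfl)
  · intro i hi
    rw [mem_sortedTuples] at hi
    rw [Finset.mem_filter, mem_sortedTuples, hp]
    exact ⟨e.strictMono.comp hi, fun l => ⟨_, rfl⟩⟩
  · intro i _ i' _ h
    exact funext fun l => e.injective (congrFun h l)
  · intro i hi
    rw [Finset.mem_filter, mem_sortedTuples, hp] at hi
    choose g hg using hi.2
    refine ⟨g, ?_, funext hg⟩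
    rw [mem_sortedTuples]
    intro a b hab
    rw [← e.lt_iff_lt, hg, hg]
    exact hi.1 hab

/-- A sorted tuple of labels below `m + 1` either avoids the label `m`, or ends with it. -/
theorem sum_sortedTuples_succ_succ {M : Type*} [AddCommMonoid M] {n m : ℕ}
    (f : (Fin (n + 1) → Fin (m + 1)) → M) :
    ∑ i ∈ sortedTuples (n + 1) (m + 1), f i
      = ∑ i ∈ sortedTuples (n + 1) m, f (fun l => (i l).castSucc)
        + ∑ i ∈ sortedTuples n m, f (Fin.snoc (fun l => (i l).castSucc) (Fin.last m)) := by
  classical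
  rw [← Finset.sum_filter_add_sum_filter_not _ (fun i => i (Fin.last n) ≠ Fin.last m)]
  congr 1
  · have hlt : ∀ x : Fin (m + 1), x ∈ Set.range Fin.castSuccOrderEmb ↔ x ≠ Fin.last m := by
      intro x
      exact Fin.exists_castSucc_eq
    have : (sortedTuples (n + 1) (m + 1)).filter (fun i => i (Fin.last n) ≠ Fin.last m)
        = (sortedTuples (n + 1) (m + 1)).filter
          (fun i => ∀ l, i l ∈ Set.range Fin.castSuccOrderEmb) := by
      refine Finset.filter_congr fun i hi => ?_
      rw [mem_sortedTuples] at hi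
      simp only [hlt]
      refine ⟨fun h l => ?_, fun h => h _⟩
      have h1 : i l ≤ i (Fin.last n) := hi.monotone (Fin.le_last l)
      exact (h1.trans_lt (Fin.lt_last_iff_ne_last.2 h)).trans_le (Fin.le_last _) |>.ne
    rw [this]
    exact sum_sortedTuples_filter_range Fin.castSuccOrderEmb f _ fun _ => Iff.rfl
  · symm
    refine Finset.sum_bij (fun i _ => Fin.snoc (fun l => (i l).castSucc) (Fin.last m))
      ?_ ?_ ?_ (fun _ _ => rfl)
    · intro i hi
      rw [mem_sortedTuples] at hi
      rw [Finset.mem_filter, mem_sortedTuples]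
      refine ⟨fun a b hab => ?_, by simp⟩
      induction b using Fin.lastCases with
      | last =>
        obtain ⟨a, rfl⟩ := Fin.exists_castSucc_eq.2 hab.ne
        simp [Fin.castSucc_lt_last]
      | cast b =>
        obtain ⟨a, rfl⟩ := Fin.exists_castSucc_eq.2 (hab.trans (Fin.castSucc_lt_last b)).ne
        simpa using hi (Fin.castSucc_lt_castSucc_iff.1 hab)
    · intro i _ i' _ h
      funext l
      simpa using congrFun h l.castSucc
    · intro i hi
      rw [Finset.mem_filter, mem_sortedTuples, not_not] at hi
      have hne : ∀ l : Fin n, i l.castSucc ≠ Fin.last m := fun l => by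
        rw [← hi.2]
        exact (hi.1 (Fin.castSucc_lt_last l)).ne
      refine ⟨fun l => (i l.castSucc).castPred (hne l), ?_, ?_⟩
      · rw [mem_sortedTuples]
        intro a b hab
        exact Fin.castPred_lt_castPred_iff.2 (hi.1 (Fin.castSucc_lt_castSucc_iff.2 hab))
      · funext l
        induction l using Fin.lastCases with
        | last => simp [hi.2]
        | cast l => simp

/-! ### The volume of a zonotope -/

theorem det_eq_of_col_last_eq_single {n : ℕ} (M : Matrix (Fin (n + 1)) (Fin (n + 1)) ℝ)
    (h : M.col (Fin.last n) = Pi.single (Fin.last n) 1) :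
    M.det = (M.submatrix Fin.castSucc Fin.castSucc).det := by
  rw [Matrix.det_succ_column M (Fin.last n), Fin.sum_univ_castSucc, Finset.sum_eq_zero]
  · have h1 : M (Fin.last n) (Fin.last n) = 1 := by
      simpa using congrFun h (Fin.last n)
    rw [h1, Fin.succAbove_last, ← two_mul, pow_mul]
    simp
  · intro l _
    have h0 : M l.castSucc (Fin.last n) = 0 := by
      simpa [Fin.castSucc_ne_last] using congrFun h l.castSucc
    simp [h0]

/-- The sum of the absolute values of the maximal minors of `Z`. -/
noncomputable def sumAbsMinors {n m : ℕ} (Z : Matrix (Fin n) (Fin m) ℝ) : ℝ :=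
  ∑ i ∈ sortedTuples n m, |(Z.submatrix id i).det|

theorem sumAbsMinors_nonneg {n m : ℕ} (Z : Matrix (Fin n) (Fin m) ℝ) : 0 ≤ sumAbsMinors Z :=
  Finset.sum_nonneg fun _ _ => abs_nonneg _

theorem det_mul_submatrix {n m : ℕ} (T : Matrix (Fin n) (Fin n) ℝ)
    (Z : Matrix (Fin n) (Fin m) ℝ) (i : Fin n → Fin m) :
    ((T * Z).submatrix id i).det = T.det * (Z.submatrix id i).det := by
  rw [← Matrix.det_mul]
  rfl

theorem sumAbsMinors_mul {n m : ℕ} (T : Matrix (Fin n) (Fin n) ℝ)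
    (Z : Matrix (Fin n) (Fin m) ℝ) : sumAbsMinors (T * Z) = |T.det| * sumAbsMinors Z := by
  simp only [sumAbsMinors, Finset.mul_sum, det_mul_submatrix, abs_mul]

/-- The shadow of a zonotope along the last coordinate axis is the zonotope of the projected
generators. -/
theorem image_init_zonotope {n m : ℕ} (Z : Matrix (Fin (n + 1)) (Fin m) ℝ) :
    (fun x : Fin (n + 1) → ℝ => (Fin.init x : Fin n → ℝ)) '' zonotope Z
      = zonotope (Z.submatrix Fin.castSucc id) := by
  have key : ∀ c : Fin m → ℝ, (Fin.init (∑ i, c i • Z.col i) : Fin n → ℝ)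
      = ∑ i, c i • (Z.submatrix Fin.castSucc id).col i := by
    intro c
    ext a
    simp [Fin.init, Finset.sum_apply]
  ext x
  constructor
  · rintro ⟨_, ⟨c, hc, rfl⟩, rfl⟩
    exact ⟨c, hc, key c⟩
  · rintro ⟨c, hc, rfl⟩
    exact ⟨_, ⟨c, hc, rfl⟩, key c⟩

theorem volume_zonotope_fin_zero {m : ℕ} (Z : Matrix (Fin 0) (Fin m) ℝ) :
    volume (zonotope Z) = ENNReal.ofReal (sumAbsMinors Z) := by
  rw [Set.Nonempty.eq_univ (zonotope_nonempty Z), sumAbsMinors, sum_sortedTuples_zero, volume_pi,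
    Measure.pi_of_empty]
  simp

/-- The volume of a zonotope is the sum of the volumes of the parallelepipeds spanned by `n` of its
generators. The proof is by induction on the number of generators, in all dimensions at once:
adding a generator adds, up to scale, the volume of the shadow along it, which is a zonotope one
dimension lower. -/
theorem volume_zonotope {n m : ℕ} (Z : Matrix (Fin n) (Fin m) ℝ) :
    volume (zonotope Z) = ENNReal.ofReal (sumAbsMinors Z) := by
  induction m generalizing n with
  | zero =>
    cases n with
    | zero =>
      exact volume_zonotope_fin_zero Z
    | succ n =>
      have : zonotope Z = {0} := by
        ext x
        simp [zonotope]
      rw [this, sumAbsMinors, sortedTuples_succ_zero]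
      simp
  | succ m ih =>
    cases n with
    | zero =>
      exact volume_zonotope_fin_zero Z
    | succ n =>
      -- When the last generator is the last unit vector, the zonotope arises by sweeping along that
      -- vector, and the minors of the projected generators are those containing that column.
      have special : ∀ W : Matrix (Fin (n + 1)) (Fin (m + 1)) ℝ,
          W.col (Fin.last m) = Pi.single (Fin.last n) 1 →
          volume (zonotope W) = ENNReal.ofReal (sumAbsMinors W) := by
        intro W hW
        rw [zonotope_succ, hW, volume_add_segment_single (isCompact_zonotope _)
          (convex_zonotope _), image_init_zonotope, ih, ih,
          ← ENNReal.ofReal_add (sumAbsMinors_nonneg _) (sumAbsMinors_nonneg _)]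
        congr 1
        rw [sumAbsMinors, sumAbsMinors, sumAbsMinors, sum_sortedTuples_succ_succ]
        congr 1
        refine Finset.sum_congr rfl fun i _ => ?_
        rw [det_eq_of_col_last_eq_single (W.submatrix id _)]
        · congr 2
          ext a b
          simp
        · ext a
          simpa using congrFun hW a
      by_cases hv : Z.col (Fin.last m) = 0
      · have hz : zonotope Z = zonotope (Z.submatrix id Fin.castSucc) := by
          rw [zonotope_succ, hv]
          simp
        rw [hz, ih]
        congr 1
        rw [sumAbsMinors, sumAbsMinors, sum_sortedTuples_succ_succ]
        refine (add_eq_left.2 ?_).symm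
        refine Finset.sum_eq_zero fun i _ => ?_
        rw [Matrix.det_eq_zero_of_column_eq_zero (Fin.last n), abs_zero]
        intro a
        simpa using congrFun hv a
      · -- Both sides scale by `|det T|`, so the last generator may be moved to the last unit vector.
        obtain ⟨e, he⟩ := SeparatingDual.exists_continuousLinearEquiv_apply_eq (R := ℝ) hv
          (y := (Pi.single (Fin.last n) 1 : Fin (n + 1) → ℝ)) (by simp)
        set T : Matrix (Fin (n + 1)) (Fin (n + 1)) ℝ :=
          LinearMap.toMatrix' (e.toLinearEquiv : (Fin (n + 1) → ℝ) →ₗ[ℝ] _) with hT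
        have hdet : |T.det| ≠ 0 := by
          rw [hT, LinearMap.det_toMatrix', abs_ne_zero]
          exact (LinearEquiv.isUnit_det' e.toLinearEquiv).ne_zero
        have hcol : (T * Z).col (Fin.last m) = Pi.single (Fin.last n) 1 := by
          have : (T * Z).col (Fin.last m) = Matrix.toLin' T (Z.col (Fin.last m)) := rfl
          rw [this, hT, Matrix.toLin'_toMatrix', ← he]
          rfl
        have h := special (T * Z) hcol
        rw [volume_zonotope_mul, sumAbsMinors_mul, ENNReal.ofReal_mul (abs_nonneg _)] at h
        exact (ENNReal.mul_right_inj (by simpa using hdet) ENNReal.ofReal_ne_top).1 h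

theorem ctrbVolume_eq_sumAbsMinors {n r : ℕ} (A : Matrix (Fin n) (Fin n) ℝ)
    (B : Matrix (Fin n) (Fin r) ℝ) (N : ℕ) :
    ctrbVolume A B N = sumAbsMinors (ctrbMatrix A B N) := by
  rw [ctrbVolume, measureReal_def, volume_zonotope, ENNReal.toReal_ofReal (sumAbsMinors_nonneg _)]

/-! ### Removing the first or the last block of `[B, AB, …, A^N B]` -/

theorem divNat_eq_zero_iff {N r : ℕ} (x : Fin (N * r)) :
    (x.divNat : ℕ) = 0 ↔ (x : ℕ) < r := by
  have hr : 0 < r := Nat.pos_of_ne_zero fun h => by subst h; exact x.elim0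
  rw [Fin.coe_divNat, Nat.div_eq_zero_iff]
  omega

theorem divNat_add_one_eq_iff {N r : ℕ} (x : Fin ((N + 1) * r)) :
    (x.divNat : ℕ) + 1 = N + 1 ↔ N * r ≤ (x : ℕ) := by
  have hr : 0 < r := Nat.pos_of_ne_zero fun h => by subst h; exact x.elim0
  rw [← Nat.le_div_iff_mul_le hr]
  have : (x.divNat : ℕ) < N + 1 := x.divNat.2
  rw [Fin.coe_divNat] at *
  omega

/-- The label in `[B, …, A^N B]` of a column of the initial part `[B, …, A^{N-1} B]`. -/
def dropLastBlock (N r : ℕ) : Fin (N * r) ↪o Fin ((N + 1) * r) :=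
  Fin.castLEOrderEmb (Nat.mul_le_mul_right r N.le_succ)

/-- The label in `[B, …, A^N B]` of a column of the final part `[AB, …, A^N B]`. -/
def dropFirstBlock (N r : ℕ) : Fin (N * r) ↪o Fin ((N + 1) * r) :=
  OrderEmbedding.ofStrictMono (fun x => ⟨x + r, by rw [Nat.add_one_mul]; omega⟩) fun x y h => by
    simpa using h

theorem mem_range_dropLastBlock {N r : ℕ} (x : Fin ((N + 1) * r)) :
    x ∈ Set.range (dropLastBlock N r) ↔ (x.divNat : ℕ) + 1 ≠ N + 1 := by
  rw [Ne, divNat_add_one_eq_iff, not_le]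
  constructor
  · rintro ⟨y, rfl⟩
    exact y.2
  · intro h
    exact ⟨⟨x, h⟩, rfl⟩

theorem mem_range_dropFirstBlock {N r : ℕ} (x : Fin ((N + 1) * r)) :
    x ∈ Set.range (dropFirstBlock N r) ↔ (x.divNat : ℕ) ≠ 0 := by
  rw [Ne, divNat_eq_zero_iff, not_lt]
  constructor
  · rintro ⟨y, rfl⟩
    exact Nat.le_add_left _ _
  · intro h
    have hx : (x : ℕ) < N * r + r := Nat.add_one_mul N r ▸ x.2
    exact ⟨⟨x - r, by omega⟩, Fin.ext (Nat.sub_add_cancel h)⟩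

theorem ctrbMatrix_submatrix_dropLastBlock {n r : ℕ} (A : Matrix (Fin n) (Fin n) ℝ)
    (B : Matrix (Fin n) (Fin r) ℝ) (N : ℕ) :
    (ctrbMatrix A B (N + 1)).submatrix id (dropLastBlock N r) = ctrbMatrix A B N := by
  ext a x
  rfl

theorem ctrbMatrix_submatrix_dropFirstBlock {n r : ℕ} (A : Matrix (Fin n) (Fin n) ℝ)
    (B : Matrix (Fin n) (Fin r) ℝ) (N : ℕ) :
    (ctrbMatrix A B (N + 1)).submatrix id (dropFirstBlock N r) = A * ctrbMatrix A B N := by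
  ext a x
  have hr : 0 < r := Nat.pos_of_ne_zero fun h => by subst h; exact x.elim0
  have hd : ((dropFirstBlock N r x).divNat : ℕ) = (x.divNat : ℕ) + 1 := Nat.add_div_right _ hr
  have hm : (dropFirstBlock N r x).modNat = x.modNat := Fin.ext (Nat.add_mod_right _ _)
  have hA : (A * ctrbMatrix A B N) a x = (A * (A ^ (x.divNat : ℕ) * B)) a x.modNat := rfl
  rw [hA, ← Matrix.mul_assoc, ← pow_succ', ← hd, ← hm]
  rfl

/-! ### Tuples of labels and the blocks they meet -/

/-- The number of columns with labels `i` that lie in block `q`. -/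
def blockCount {n r N : ℕ} (q : ℕ) (i : Fin n → Fin (N * r)) : ℕ :=
  (Finset.univ.filter fun l => ((i l).divNat : ℕ) = q).card

theorem blockCount_eq_zero {n r N : ℕ} {q : ℕ} {i : Fin n → Fin (N * r)} :
    blockCount q i = 0 ↔ ∀ l, ((i l).divNat : ℕ) ≠ q := by
  rw [blockCount, Finset.card_eq_zero, Finset.filter_eq_empty_iff]
  simp only [Finset.mem_univ, true_imp_iff, Ne]

theorem divNat_monotone {N r : ℕ} {x y : Fin (N * r)} (h : x ≤ y) :
    (x.divNat : ℕ) ≤ (y.divNat : ℕ) := Nat.div_le_div_right h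

/-- Within one block, a column is determined by its position modulo `r`. -/
theorem blockCount_le {n r N : ℕ} (q : ℕ) {i : Fin n → Fin (N * r)}
    (hi : Function.Injective i) : blockCount q i ≤ r := by
  have := Finset.card_le_card_of_injOn (s := Finset.univ.filter fun l => ((i l).divNat : ℕ) = q)
    (t := (Finset.univ : Finset (Fin r))) (fun l => (i l).modNat) (by simp) ?_
  · simpa [blockCount] using this
  · intro l hl l' hl' h
    simp only [Finset.coe_filter, Finset.mem_univ, true_and, Set.mem_ofPred_eq] at hl hl'
    apply hi
    ext
    have h1 := Nat.div_add_mod (i l : ℕ) r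
    have h2 := Nat.div_add_mod (i l' : ℕ) r
    have h3 : (i l : ℕ) / r = q := hl
    have h4 : (i l' : ℕ) / r = q := hl'
    have h5 : (i l : ℕ) % r = (i l' : ℕ) % r := congrArg Fin.val h
    rw [← h1, ← h2, h3, h4, h5]

theorem card_filter_val_lt {n j : ℕ} (hj : j ≤ n) :
    (Finset.univ.filter fun l : Fin n => (l : ℕ) < j).card = j := by
  rw [Fin.card_filter_val_lt, min_eq_right hj]

theorem card_filter_sub_le_val {n k : ℕ} (hk : k ≤ n) :
    (Finset.univ.filter fun l : Fin n => n - k ≤ (l : ℕ)).card = k := by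
  have h := Finset.card_filter_add_card_filter_not (s := (Finset.univ : Finset (Fin n)))
    (fun l => (l : ℕ) < n - k)
  rw [card_filter_val_lt (Nat.sub_le n k), Finset.card_fin] at h
  simp only [not_lt] at h
  omega

/-- A predicate that is inherited by smaller indices holds exactly for the first few indices. -/
theorem iff_lt_card_filter {n : ℕ} (p : Fin n → Prop) [DecidablePred p]
    (hp : ∀ a b, a ≤ b → p b → p a) (l : Fin n) :
    p l ↔ (l : ℕ) < (Finset.univ.filter p).card := by
  constructor
  · intro h
    have hsub : Finset.Iic l ⊆ Finset.univ.filter p := fun a ha => by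
      simpa using hp a l (Finset.mem_Iic.1 ha) h
    have := Finset.card_le_card hsub
    rw [Fin.card_Iic] at this
    omega
  · intro h
    by_contra hl
    have hsub : Finset.univ.filter p ⊆ Finset.Iio l := fun a ha => by
      rw [Finset.mem_filter] at ha
      rw [Finset.mem_Iio]
      by_contra hla
      exact hl (hp l a (not_lt.1 hla) ha.2)
    have := Finset.card_le_card hsub
    rw [Fin.card_Iio] at this
    omega

/-- The prescribed pattern of blocks says how many of the labels lie in the first and in the last
block. -/
theorem mem_mixedTuples_iff {n r N j k : ℕ} (i : Fin n → Fin ((N + 2) * r)) :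
    i ∈ mixedTuples n r (N + 2) j k
      ↔ i ∈ sortedTuples n ((N + 2) * r) ∧ blockCount 0 i = j ∧ blockCount (N + 1) i = k := by
  rw [mixedTuples, Finset.mem_filter]
  refine and_congr_right fun hi => ?_
  rw [mem_sortedTuples] at hi
  constructor
  · rintro ⟨hjk, h⟩
    constructor
    · rw [← card_filter_val_lt (show j ≤ n by omega), blockCount]
      congr 1
      refine Finset.filter_congr fun l _ => ?_
      obtain ⟨h1, h2, h3⟩ := h l
      omega
    · rw [← card_filter_sub_le_val (show k ≤ n by omega), blockCount]
      congr 1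
      refine Finset.filter_congr fun l _ => ?_
      obtain ⟨h1, h2, h3⟩ := h l
      omega
  · rintro ⟨hj, hk⟩
    have hlt : ∀ l, ((i l).divNat : ℕ) < N + 2 := fun l => (i l).divNat.2
    have hmono : ∀ a b, a ≤ b → ((i a).divNat : ℕ) ≤ ((i b).divNat : ℕ) := fun a b hab =>
      divNat_monotone (hi.monotone hab)
    -- A sorted tuple runs through the blocks in order, so the labels in block `0` and those outside
    -- the last block form initial segments.
    have h0 := iff_lt_card_filter (fun l => ((i l).divNat : ℕ) = 0) fun a b hab hb => by
      have := hmono a b hab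
      omega
    have h1 := iff_lt_card_filter (fun l => ((i l).divNat : ℕ) ≠ N + 1) fun a b hab hb => by
      have := hmono a b hab
      have := hlt b
      omega
    have hc := Finset.card_filter_add_card_filter_not (s := (Finset.univ : Finset (Fin n)))
      (fun l => ((i l).divNat : ℕ) = N + 1)
    have hdisj : (Finset.univ.filter fun l => ((i l).divNat : ℕ) = 0).card
        ≤ (Finset.univ.filter fun l => ((i l).divNat : ℕ) ≠ N + 1).card :=
      Finset.card_le_card fun l hl => by
        simp only [Finset.mem_filter, Finset.mem_univ, true_and] at hl ⊢
        omega
    rw [Finset.card_fin] at hc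
    simp only [blockCount] at hj hk
    simp only [hj] at h0 hdisj
    simp only [hk] at hc
    simp only [← Ne.eq_def] at hc
    refine ⟨by omega, fun l => ?_⟩
    have h0 := h0 l
    have h1 := h1 l
    have := hlt l
    omega

/-- Summing over all admissible patterns amounts to summing over the tuples with labels both in the
first and in the last block. -/
theorem sum_mixedTuples {M : Type*} [AddCommMonoid M] {n r N : ℕ}
    (f : (Fin n → Fin ((N + 2) * r)) → M) :
    ∑ j ∈ Finset.Icc 1 r, ∑ k ∈ Finset.Icc 1 r, ∑ i ∈ mixedTuples n r (N + 2) j k, f i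
      = ∑ i ∈ (sortedTuples n ((N + 2) * r)).filter
          (fun i => 0 < blockCount 0 i ∧ 0 < blockCount (N + 1) i), f i := by
  rw [← Finset.sum_product',
    ← Finset.sum_fiberwise_of_maps_to (t := Finset.Icc 1 r ×ˢ Finset.Icc 1 r)
      (g := fun i => (blockCount 0 i, blockCount (N + 1) i))]
  · refine Finset.sum_congr rfl fun x hx => ?_
    rw [Finset.mem_product, Finset.mem_Icc, Finset.mem_Icc] at hx
    congr 1
    ext i
    simp only [mem_mixedTuples_iff, Finset.mem_filter, Prod.ext_iff]
    constructor
    · rintro ⟨h1, h2, h3⟩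
      exact ⟨⟨h1, by omega⟩, h2, h3⟩
    · rintro ⟨⟨h1, _⟩, h2, h3⟩
      exact ⟨h1, h2, h3⟩
  · intro i hi
    rw [Finset.mem_filter, mem_sortedTuples] at hi
    have h0 := blockCount_le 0 hi.1.injective
    have h1 := blockCount_le (N + 1) hi.1.injective
    simp only [Finset.mem_product, Finset.mem_Icc]
    omega

/-! ### The recursion -/

/-- The minors without a column of the last block are the minors of `[B, …, A^{N-1} B]`. -/
theorem sum_no_last {n r : ℕ} (A : Matrix (Fin n) (Fin n) ℝ) (B : Matrix (Fin n) (Fin r) ℝ)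
    (N : ℕ) :
    ∑ i ∈ (sortedTuples n ((N + 1) * r)).filter (fun i => blockCount N i = 0),
      |((ctrbMatrix A B (N + 1)).submatrix id i).det| = sumAbsMinors (ctrbMatrix A B N) := by
  rw [sum_sortedTuples_filter_range (dropLastBlock N r), sumAbsMinors,
    ← ctrbMatrix_submatrix_dropLastBlock A B N]
  · rfl
  · intro i
    rw [blockCount_eq_zero]
    simp only [mem_range_dropLastBlock, Ne, Nat.add_right_cancel_iff]

/-- The minors without a column of `B` are those of `[AB, …, A^N B] = A [B, …, A^{N-1} B]`. -/
theorem sum_no_first {n r : ℕ} (A : Matrix (Fin n) (Fin n) ℝ) (B : Matrix (Fin n) (Fin r) ℝ)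
    (N : ℕ) :
    ∑ i ∈ (sortedTuples n ((N + 1) * r)).filter (fun i => blockCount 0 i = 0),
      |((ctrbMatrix A B (N + 1)).submatrix id i).det|
      = |A.det| * sumAbsMinors (ctrbMatrix A B N) := by
  rw [sum_sortedTuples_filter_range (dropFirstBlock N r), ← sumAbsMinors_mul, sumAbsMinors,
    ← ctrbMatrix_submatrix_dropFirstBlock A B N]
  · rfl
  · intro i
    rw [blockCount_eq_zero]
    simp only [mem_range_dropFirstBlock]

theorem sum_no_first_no_last {n r : ℕ} (A : Matrix (Fin n) (Fin n) ℝ)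
    (B : Matrix (Fin n) (Fin r) ℝ) (N : ℕ) :
    ∑ i ∈ (sortedTuples n ((N + 2) * r)).filter
        (fun i => blockCount 0 i = 0 ∧ blockCount (N + 1) i = 0),
      |((ctrbMatrix A B (N + 2)).submatrix id i).det|
      = |A.det| * sumAbsMinors (ctrbMatrix A B N) := by
  rw [sum_sortedTuples_filter_range ((dropFirstBlock N r).trans (dropLastBlock (N + 1) r)),
    ← sumAbsMinors_mul, sumAbsMinors, ← ctrbMatrix_submatrix_dropFirstBlock A B N,
    ← ctrbMatrix_submatrix_dropLastBlock A B (N + 1)]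
  · rfl
  · intro i
    rw [blockCount_eq_zero, blockCount_eq_zero, ← forall_and]
    refine forall_congr' fun l => ?_
    constructor
    · intro h
      obtain ⟨x, hx⟩ := (mem_range_dropLastBlock (i l)).2 (by omega)
      have hx0 : (x.divNat : ℕ) ≠ 0 := by
        have := h.1
        rwa [← hx] at this
      obtain ⟨y, rfl⟩ := (mem_range_dropFirstBlock x).2 hx0
      exact ⟨y, hx⟩
    · rintro ⟨y, hy⟩
      rw [← hy]
      have h1 := (mem_range_dropLastBlock (N := N + 1) _).1 ⟨dropFirstBlock N r y, rfl⟩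
      have h2 := (mem_range_dropFirstBlock (N := N) _).1 ⟨y, rfl⟩
      exact ⟨h2, fun h => h1 (congrArg (· + 1) h)⟩

/-- Inclusion–exclusion on the tuples that avoid the last block and those that avoid the first. -/
theorem sumAbsMinors_ctrbMatrix_add_two {n r : ℕ} (A : Matrix (Fin n) (Fin n) ℝ)
    (B : Matrix (Fin n) (Fin r) ℝ) (N : ℕ) :
    sumAbsMinors (ctrbMatrix A B (N + 2))
      = (1 + |A.det|) * sumAbsMinors (ctrbMatrix A B (N + 1))
        - |A.det| * sumAbsMinors (ctrbMatrix A B N)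
        + ∑ j ∈ Finset.Icc 1 r, ∑ k ∈ Finset.Icc 1 r, ∑ i ∈ mixedTuples n r (N + 2) j k,
            |((ctrbMatrix A B (N + 2)).submatrix id i).det| := by
  have e : ∀ a b c d s : ℝ, s + c = a + b + d → s = a + b - c + d := fun a b c d s h => by
    linarith
  rw [one_add_mul (|A.det|)]
  apply e
  rw [sum_mixedTuples, ← sum_no_first A B (N + 1), ← sum_no_last A B (N + 1),
    ← sum_no_first_no_last A B N, sumAbsMinors, Finset.sum_filter, Finset.sum_filter,
    Finset.sum_filter, Finset.sum_filter, ← Finset.sum_add_distrib, ← Finset.sum_add_distrib,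
    ← Finset.sum_add_distrib]
  refine Finset.sum_congr rfl fun i _ => ?_
  by_cases h : blockCount 0 i = 0 <;> by_cases h' : blockCount (N + 1) i = 0 <;>
    simp [h, h', Nat.pos_iff_ne_zero]

theorem ctrbVolume_add_two {n r : ℕ} (A : Matrix (Fin n) (Fin n) ℝ)
    (B : Matrix (Fin n) (Fin r) ℝ) (N : ℕ) :
    ctrbVolume A B (N + 2)
      = (1 + |A.det|) * ctrbVolume A B (N + 1) - |A.det| * ctrbVolume A B N
        + ∑ j ∈ Finset.Icc 1 r, ∑ k ∈ Finset.Icc 1 r, ∑ i ∈ mixedTuples n r (N + 2) j k,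
            |((ctrbMatrix A B (N + 2)).submatrix id i).det| := by
  simp only [ctrbVolume_eq_sumAbsMinors]
  exact sumAbsMinors_ctrbMatrix_add_two A B N

theorem ctrbVolume_zero {n r : ℕ} (hn : 1 ≤ n) (A : Matrix (Fin n) (Fin n) ℝ)
    (B : Matrix (Fin n) (Fin r) ℝ) : ctrbVolume A B 0 = 0 := by
  rw [ctrbVolume_eq_sumAbsMinors, sumAbsMinors]
  refine Finset.sum_eq_zero fun i _ => ?_
  exact absurd (i ⟨0, hn⟩).2 (by simp)

theorem ctrbVolume_one {n r : ℕ} (A : Matrix (Fin n) (Fin n) ℝ) (B : Matrix (Fin n) (Fin r) ℝ) :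
    ctrbVolume A B 1 = ∑ i ∈ sortedTuples n r, |(B.submatrix id i).det| := by
  rw [ctrbVolume_eq_sumAbsMinors, sumAbsMinors]
  have hcol : (ctrbMatrix A B 1).submatrix id (Fin.cast (one_mul r).symm) = B := by
    ext a x
    have hx : ((Fin.cast (one_mul r).symm x).divNat : ℕ) = 0 := Nat.div_eq_of_lt x.2
    have hy : (Fin.cast (one_mul r).symm x).modNat = x := Fin.ext (Nat.mod_eq_of_lt x.2)
    rw [Matrix.submatrix_apply, ctrbMatrix, blockRow, Matrix.of_apply, hx, hy, pow_zero,
      Matrix.one_mul]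
    rfl
  have h := sum_sortedTuples_filter_range (n := n) (Fin.castOrderIso (one_mul r).symm).toOrderEmbedding
    (fun i => |((ctrbMatrix A B 1).submatrix id i).det|) (fun _ => True)
    (fun i => by simp [(Fin.castOrderIso (one_mul r).symm).surjective.range_eq])
  rw [Finset.filter_true_of_mem fun _ _ => trivial] at h
  rw [h]
  refine Finset.sum_congr rfl fun i _ => ?_
  rw [← congrArg (fun X => X.submatrix id i) hcol]
  rfl

/-! ### Counting the mixed tuples -/

/-- Up to a factor that depends only on `n` and `r`, the number of tuples of column labels of
`[B, …, A^{N-1} B]` that meet both the first and the last block: two of the `n` labels are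
confined to these blocks. For `n = 1` there are no such tuples. -/
def mixedGrowth (n N : ℕ) : ℕ := if n = 1 then 0 else N ^ (n - 2)

theorem mixedGrowth_mono (n : ℕ) {M N : ℕ} (h : M ≤ N) : mixedGrowth n M ≤ mixedGrowth n N := by
  unfold mixedGrowth
  split_ifs
  · exact le_rfl
  · exact Nat.pow_le_pow_left h _

theorem mul_mixedGrowth_le {n : ℕ} (hn : 1 ≤ n) (N : ℕ) :
    N * mixedGrowth n (N + 1) ≤ (N + 1) ^ (n - 1) := by
  unfold mixedGrowth
  split_ifs with h
  · simp
  · rw [show n - 1 = (n - 2) + 1 by omega, pow_succ']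
    exact Nat.mul_le_mul_right _ N.le_succ

theorem card_filter_divNat_eq_le (N r q : ℕ) :
    (Finset.univ.filter fun x : Fin (N * r) => (x.divNat : ℕ) = q).card ≤ r :=
  blockCount_le q (i := id) Function.injective_id

theorem card_mixedTuples_le {n r N j k : ℕ} (hn : 1 ≤ n) (hj : 1 ≤ j) (hk : 1 ≤ k) :
    (mixedTuples n r N j k).card ≤ r ^ n * mixedGrowth n N := by
  unfold mixedGrowth
  split_ifs with h
  · rw [mul_zero, Nat.le_zero, Finset.card_eq_zero, Finset.eq_empty_iff_forall_notMem]
    intro i hi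
    have := (Finset.mem_filter.1 hi).2.1
    omega
  · obtain ⟨m, rfl⟩ : ∃ m, n = m + 2 := ⟨n - 2, by omega⟩
    -- The first label lies in the first block, the last one in the last block; nothing more is
    -- used about the labels in between.
    let F : Finset (Fin (N * r)) := Finset.univ.filter fun x => (x.divNat : ℕ) = 0
    let G : Finset (Fin (N * r)) := Finset.univ.filter fun x => (x.divNat : ℕ) = N - 1
    let S : Fin (m + 2) → Finset (Fin (N * r)) :=
      Fin.cons F (Fin.snoc (fun _ : Fin m => Finset.univ) G)
    have hsub : mixedTuples (m + 2) r N j k ⊆ Fintype.piFinset S := by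
      intro i hi
      have hi := (Finset.mem_filter.1 hi).2.2
      rw [Fintype.mem_piFinset]
      intro l
      induction l using Fin.cases with
      | zero =>
        simp only [S, F, Fin.cons_zero, Finset.mem_filter, Finset.mem_univ, true_and]
        exact (hi 0).1 hj
      | succ l =>
        induction l using Fin.lastCases with
        | last =>
          simp only [S, G, Fin.cons_succ, Fin.snoc_last, Finset.mem_filter, Finset.mem_univ,
            true_and]
          have := (hi (Fin.last m).succ).2.2 (by simp only [Fin.val_succ, Fin.val_last]; omega)
          omega
        | cast l => simp [S]
    have hF : F.card ≤ r := card_filter_divNat_eq_le N r 0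
    have hG : G.card ≤ r := card_filter_divNat_eq_le N r (N - 1)
    calc (mixedTuples (m + 2) r N j k).card
        ≤ (Fintype.piFinset S).card := Finset.card_le_card hsub
      _ = F.card * ((N * r) ^ m * G.card) := by
          rw [Fintype.card_piFinset, Fin.prod_univ_succ, Fin.prod_univ_castSucc]
          simp [S]
      _ ≤ r * ((N * r) ^ m * r) := Nat.mul_le_mul hF (Nat.mul_le_mul_left _ hG)
      _ = r ^ (m + 2) * N ^ (m + 2 - 2) := by
          rw [Nat.add_sub_cancel]
          ring

/-! ### Correctness and cost of the recursive algorithm -/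

theorem volumeStage_val {n r : ℕ} (hn : 1 ≤ n) (A : Matrix (Fin n) (Fin n) ℝ)
    (B : Matrix (Fin n) (Fin r) ℝ) (N : ℕ) :
    (volumeStage A B |A.det| N).val
      = ⟨ctrbVolume A B (N + 1), ctrbVolume A B N, fun k => A ^ (k : ℕ) * B⟩ := by
  induction N with
  | zero =>
    have hb : (fun k : Fin (0 + 1) => A ^ (k : ℕ) * B) = fun _ => B := by
      funext k
      rw [Fin.val_eq_zero k, pow_zero, Matrix.one_mul]
    rw [hb, ctrbVolume_zero hn, show ctrbVolume A B (0 + 1) = _ from ctrbVolume_one A B]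
    rfl
  | succ N ih =>
    have hb : (Fin.snoc (fun k : Fin (N + 1) => A ^ (k : ℕ) * B) (A * (A ^ N * B)) :
        Fin (N + 2) → Matrix (Fin n) (Fin r) ℝ) = fun k : Fin (N + 2) => A ^ (k : ℕ) * B := by
      funext k
      induction k using Fin.lastCases with
      | last => rw [Fin.snoc_last, ← Matrix.mul_assoc, ← pow_succ', Fin.val_last]
      | cast k => rw [Fin.snoc_castSucc, Fin.val_castSucc]
    -- One stage of the algorithm, for an arbitrary state `S` in place of the previous one, so that
    -- the induction hypothesis can be substituted.
    have hstep : ∀ S : VolumeState n r (N + 1), (volumeStage A B |A.det| N).val = S →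
        (volumeStage A B |A.det| (N + 1)).val
          = ⟨(1 + |A.det|) * S.cur - |A.det| * S.prev
              + ∑ j ∈ Finset.Icc 1 r, ∑ k ∈ Finset.Icc 1 r, ∑ i ∈ mixedTuples n r (N + 2) j k,
                |((blockRow (Fin.snoc S.blocks (A * S.blocks (Fin.last N)) :
                  Fin (N + 2) → Matrix (Fin n) (Fin r) ℝ)).submatrix id i).det|,
            S.cur, Fin.snoc S.blocks (A * S.blocks (Fin.last N))⟩ := by
      rintro S rfl
      rfl
    rw [hstep _ ih]
    simp only [Fin.val_last, hb, ctrbVolume_add_two A B N]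
    rfl

theorem volumeStage_dets_zero {n r : ℕ} (A : Matrix (Fin n) (Fin n) ℝ)
    (B : Matrix (Fin n) (Fin r) ℝ) (d : ℝ) :
    (volumeStage A B d 0).dets = (sortedTuples n r).card := by
  have h : (volumeStage A B d 0).dets = (∑ _i ∈ sortedTuples n r, 1) + 0 := rfl
  rw [h, add_zero, Finset.card_eq_sum_ones]

theorem volumeStage_ops_zero {n r : ℕ} (A : Matrix (Fin n) (Fin n) ℝ)
    (B : Matrix (Fin n) (Fin r) ℝ) (d : ℝ) :
    (volumeStage A B d 0).ops = 2 * (sortedTuples n r).card := by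
  have h : (volumeStage A B d 0).ops = (∑ _i ∈ sortedTuples n r, (1 + 1)) + 0 := rfl
  rw [h, add_zero, Finset.sum_const, smul_eq_mul, mul_comm]

theorem volumeStage_dets_succ {n r : ℕ} (A : Matrix (Fin n) (Fin n) ℝ)
    (B : Matrix (Fin n) (Fin r) ℝ) (d : ℝ) (N : ℕ) :
    (volumeStage A B d (N + 1)).dets = (volumeStage A B d N).dets
      + ∑ j ∈ Finset.Icc 1 r, ∑ k ∈ Finset.Icc 1 r, (mixedTuples n r (N + 2) j k).card := by
  have h : (volumeStage A B d (N + 1)).dets = (volumeStage A B d N).dets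
      + (0 + ((∑ j ∈ Finset.Icc 1 r, ∑ k ∈ Finset.Icc 1 r,
        ∑ _i ∈ mixedTuples n r (N + 2) j k, 1) + (0 + (0 + (0 + (0 + (0 + 0))))))) := rfl
  simp only [h, ← Finset.card_eq_sum_ones, zero_add, add_zero]

theorem volumeStage_ops_succ {n r : ℕ} (A : Matrix (Fin n) (Fin n) ℝ)
    (B : Matrix (Fin n) (Fin r) ℝ) (d : ℝ) (N : ℕ) :
    (volumeStage A B d (N + 1)).ops = (volumeStage A B d N).ops
      + (n * r * (n + n) + ((∑ j ∈ Finset.Icc 1 r,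
          ((∑ k ∈ Finset.Icc 1 r, (2 * (mixedTuples n r (N + 2) j k).card + 1)) + 1)) + 5)) := by
  have h : (volumeStage A B d (N + 1)).ops = (volumeStage A B d N).ops
      + (n * r * (n + n) + ((∑ j ∈ Finset.Icc 1 r, ((∑ k ∈ Finset.Icc 1 r,
        ((∑ _i ∈ mixedTuples n r (N + 2) j k, (1 + 1)) + 1)) + 1))
          + (1 + (1 + (1 + (1 + (1 + 0))))))) := rfl
  rw [h]
  simp only [Finset.sum_const, smul_eq_mul, Nat.reduceAdd, mul_comm _ 2]

theorem sum_Icc_one_le (r b : ℕ) (f : ℕ → ℕ) (h : ∀ j, 1 ≤ j → f j ≤ b) :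
    ∑ j ∈ Finset.Icc 1 r, f j ≤ r * b := by
  have := Finset.sum_le_card_nsmul (Finset.Icc 1 r) f b fun j hj => h j (Finset.mem_Icc.1 hj).1
  simpa using this

/-- The bound is uniform over the stages up to `M`, since `mixedGrowth` is monotone. -/
theorem volumeStage_dets_le {n r : ℕ} (hn : 1 ≤ n) (A : Matrix (Fin n) (Fin n) ℝ)
    (B : Matrix (Fin n) (Fin r) ℝ) (d : ℝ) {N M : ℕ} (h : N ≤ M) :
    (volumeStage A B d N).dets
      ≤ (sortedTuples n r).card + N * (r * (r * (r ^ n * mixedGrowth n (M + 1)))) := by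
  induction N with
  | zero => rw [volumeStage_dets_zero]; omega
  | succ N ih =>
    have hg := mixedGrowth_mono n (show N + 2 ≤ M + 1 by omega)
    have hs := sum_Icc_one_le r (r * (r ^ n * mixedGrowth n (M + 1)))
      (fun j => ∑ k ∈ Finset.Icc 1 r, (mixedTuples n r (N + 2) j k).card) fun j hj =>
        sum_Icc_one_le r _ _ fun k hk =>
          (card_mixedTuples_le hn hj hk).trans (Nat.mul_le_mul_left _ hg)
    rw [volumeStage_dets_succ, Nat.add_one_mul N (r * (r * _))]
    have := ih (by omega)
    omega

/-- The analogue of `volumeStage_dets_le` for the other operations. -/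
theorem volumeStage_ops_le {n r : ℕ} (hn : 1 ≤ n) (A : Matrix (Fin n) (Fin n) ℝ)
    (B : Matrix (Fin n) (Fin r) ℝ) (d : ℝ) {N M : ℕ} (h : N ≤ M) :
    (volumeStage A B d N).ops
      ≤ 2 * (sortedTuples n r).card + N * (n * r * (n + n)
        + (r * (r * (2 * (r ^ n * mixedGrowth n (M + 1)) + 1) + 1) + 5)) := by
  induction N with
  | zero => rw [volumeStage_ops_zero]; omega
  | succ N ih =>
    have hg := mixedGrowth_mono n (show N + 2 ≤ M + 1 by omega)
    have hs := sum_Icc_one_le r (r * (2 * (r ^ n * mixedGrowth n (M + 1)) + 1) + 1)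
      (fun j => (∑ k ∈ Finset.Icc 1 r, (2 * (mixedTuples n r (N + 2) j k).card + 1)) + 1)
      fun j hj => Nat.add_le_add_right (sum_Icc_one_le r _ _ fun k hk =>
        Nat.add_le_add_right (Nat.mul_le_mul_left 2
          ((card_mixedTuples_le hn hj hk).trans (Nat.mul_le_mul_left _ hg))) 1) 1
    rw [volumeStage_ops_succ, Nat.add_one_mul N (_ + _)]
    have := ih (by omega)
    omega

theorem recursiveVolume_val {n r : ℕ} (hn : 1 ≤ n) (A : Matrix (Fin n) (Fin n) ℝ)
    (B : Matrix (Fin n) (Fin r) ℝ) (N : ℕ) :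
    (recursiveVolume A B N).val = ctrbVolume A B N := by
  cases N with
  | zero => exact (ctrbVolume_zero hn A B).symm
  | succ N => exact congrArg VolumeState.cur (volumeStage_val hn A B N)

theorem recursiveVolume_dets_le {n r : ℕ} (hn : 1 ≤ n) (A : Matrix (Fin n) (Fin n) ℝ)
    (B : Matrix (Fin n) (Fin r) ℝ) (N : ℕ) :
    (recursiveVolume A B N).dets
      ≤ (1 + (sortedTuples n r).card + r * r * r ^ n) * N ^ (n - 1) := by
  cases N with
  | zero => exact Nat.zero_le _
  | succ N =>
    have hs := volumeStage_dets_le hn A B |A.det| (le_refl N)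
    have h1 : 1 ≤ (N + 1) ^ (n - 1) := Nat.one_le_pow _ _ N.succ_pos
    calc (recursiveVolume A B (N + 1)).dets
        = 1 + (volumeStage A B |A.det| N).dets := rfl
      _ ≤ (1 + (sortedTuples n r).card) * 1
          + r * r * r ^ n * (N * mixedGrowth n (N + 1)) := by
          refine (Nat.add_le_add_left hs 1).trans_eq ?_
          ring
      _ ≤ (1 + (sortedTuples n r).card) * (N + 1) ^ (n - 1)
          + r * r * r ^ n * (N + 1) ^ (n - 1) :=
          Nat.add_le_add (Nat.mul_le_mul_left _ h1)
            (Nat.mul_le_mul_left _ (mul_mixedGrowth_le hn N))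
      _ = _ := (Nat.add_mul _ _ _).symm

theorem recursiveVolume_ops_le {n r : ℕ} (hn : 1 ≤ n) (A : Matrix (Fin n) (Fin n) ℝ)
    (B : Matrix (Fin n) (Fin r) ℝ) (N : ℕ) :
    (recursiveVolume A B N).ops
      ≤ (1 + 2 * (sortedTuples n r).card + (n * r * (n + n) + r * r + r + 5)
        + 2 * (r * r * r ^ n)) * N ^ max (n - 1) 1 := by
  cases N with
  | zero => exact Nat.zero_le _
  | succ N =>
    have hs := volumeStage_ops_le hn A B |A.det| (le_refl N)
    have h1 : 1 ≤ (N + 1) ^ max (n - 1) 1 := Nat.one_le_pow _ _ N.succ_pos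
    have h2 : N ≤ (N + 1) ^ max (n - 1) 1 :=
      N.le_succ.trans (Nat.le_self_pow (by omega) _)
    have h3 : N * mixedGrowth n (N + 1) ≤ (N + 1) ^ max (n - 1) 1 :=
      (mul_mixedGrowth_le hn N).trans (Nat.pow_le_pow_right N.succ_pos (le_max_left _ _))
    calc (recursiveVolume A B (N + 1)).ops
        = 1 + (volumeStage A B |A.det| N).ops := rfl
      _ ≤ (1 + 2 * (sortedTuples n r).card) * 1 + (n * r * (n + n) + r * r + r + 5) * N
          + 2 * (r * r * r ^ n) * (N * mixedGrowth n (N + 1)) := by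
          refine (Nat.add_le_add_left hs 1).trans_eq ?_
          ring
      _ ≤ (1 + 2 * (sortedTuples n r).card) * (N + 1) ^ max (n - 1) 1
          + (n * r * (n + n) + r * r + r + 5) * (N + 1) ^ max (n - 1) 1
          + 2 * (r * r * r ^ n) * (N + 1) ^ max (n - 1) 1 :=
          Nat.add_le_add (Nat.add_le_add (Nat.mul_le_mul_left _ h1) (Nat.mul_le_mul_left _ h2))
            (Nat.mul_le_mul_left _ h3)
      _ = _ := by rw [← Nat.add_mul, ← Nat.add_mul]

/-- The recursion for the volume of the zonotope generated by `[B, AB, …, A^{N-1}B]`, and the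
`O(N^{n-1})` complexity of the recursive algorithm, with a constant that depends only on `n` and
`r`. -/
theorem corollary1 (n r : ℕ) (hn : 1 ≤ n) :
    (∀ (A : Matrix (Fin n) (Fin n) ℝ) (B : Matrix (Fin n) (Fin r) ℝ) (N : ℕ), 2 ≤ N →
      ctrbVolume A B N =
        (1 + |A.det|) * ctrbVolume A B (N - 1) - |A.det| * ctrbVolume A B (N - 2)
          + ∑ j ∈ Finset.Icc 1 r, ∑ k ∈ Finset.Icc 1 r, ∑ i ∈ mixedTuples n r N j k,
              |((ctrbMatrix A B N).submatrix id i).det|) ∧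
    (∃ C : ℕ, ∀ (A : Matrix (Fin n) (Fin n) ℝ) (B : Matrix (Fin n) (Fin r) ℝ) (N : ℕ),
      (recursiveVolume A B N).val = ctrbVolume A B N ∧
      (recursiveVolume A B N).dets ≤ C * N ^ (n - 1) ∧
      (recursiveVolume A B N).ops ≤ C * N ^ max (n - 1) 1) := by
  constructor
  · intro A B N hN
    obtain ⟨M, rfl⟩ : ∃ M, N = M + 2 := ⟨N - 2, by omega⟩
    exact ctrbVolume_add_two A B M
  · exact ⟨max _ _, fun A B N => ⟨recursiveVolume_val hn A B N,
      (recursiveVolume_dets_le hn A B N).trans (Nat.mul_le_mul_right _ (le_max_left _ _)),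
      (recursiveVolume_ops_le hn A B N).trans (Nat.mul_le_mul_right _ (le_max_right _ _))⟩⟩
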